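/- Conventions. Let $N\ge 3$ and let $k$ be a field of characteristic $0$ or $>N$. $E(N,d)$ is the set of symmetric $N\times N$ matrices of nonnegative integers with zero diagonal and all row sums equal to $d$. For such $A=[a_{ij}]$ put $\delta(z,A)=\prod_{i<j}(z_i-z_j)^{a_{ij}}$, and for $f\in k[z_1,\dots,z_N]$ put $\mathrm{Symm}_N(f)=\sum_{\sigma\in S_N} f(z_{\sigma(1)},\dots,z_{\sigma(N)})$. For $M\ge2$ let $e_1,\dots,e_M$ be the elementary symmetric polynomials of $z_1,\dots,z_M$, let $a_0$ be an indeterminate, $a_i=a_0e_i$, and let $F=\sum_i a_iX^iY^{M-i}$ be the generic binary $M$-ic. An invariant of $F$ of degree $d$ and weight $w=Md/2$ is an element $a_0^d\,g$ of $k[a_0,\dots,a_M]$, with $g=P(e_1,\dots,e_M)$, where $P$ has total degree $\le d$ in $e_1,\dots,e_M$ and $g$ is homogeneous of degree $w$ in the $z_i$ and unchanged by $z_i\mapsto z_i+t$ (for an indeterminate $t$); we then also call $g$ an invariant. It is skew if $w$ is odd. $I$ is the identity matrix and $D_m$ is the $m\times m$ matrix with $0$ on the diagonal and $1$ elsewhere.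 **Theorem 2.** (i) Let $m,n,a,b$ be positive integers with $n\ge2$, $N=mn$, and let $d=2a(n-1)+(m-1)(n-1)b$. Let $E$ be the $n\times n$ block matrix with zero diagonal blocks and all off-diagonal blocks equal to $2aI+bD_m$. Then $E\in E(N,d)$ and $\mathrm{Symm}_N(\delta(z,E))$ is a nonzero invariant of degree $d$ of the binary $N$-ic. (ii) Let $m,n,r,a,b$ be positive integers with $n\ge2$, $1\le r\le mn-1$, $N=2mn-r$, such that $c=\dfrac{2(n-1)a+(m-1)(n-1)b}{r}$ is an integer. Let $E$ be the $(n+1)\times(n+1)$ block matrix with zero diagonal blocks, $n$ of size $m$ and one of size $mn-r$, the latter placed first if $mn-r\le m$ and last if $mn-r>m$; the off-diagonal blocks between two of the $n$ parts of size $m$ are $2aI+bD_m$, and all entries in the off-diagonal blocks involving the part of size $mn-r$ are $c$. Then $E\in E(N,mnc)$ and $\mathrm{Symm}_N(\delta(z,E))$ is a nonzero invariant of degree $mnc$ of the binary $N$-ic. (iii) Let $l,m,n,d$ be positive integers with $l<m<n<l+m$, $N=l+m+n$, such that $$a=\frac{(m+l-n)d}{2lm},\qquad b=\frac{(l+n-m)d}{2ln},\qquad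 c=\frac{(m+n-l)d}{2mn}$$ are integers. Let $E$ be the symmetric $3\times3$ block matrix with zero diagonal blocks of sizes $l,m,n$ and with all entries of the blocks in positions $(1,2)$, $(1,3)$, $(2,3)$ equal to $a,b,c$ respectively. Then $E\in E(N,d)$ and $\mathrm{Symm}_N(\delta(z,E))$ is a nonzero invariant of degree $d$ of the binary $N$-ic. (iv) Let $s\ge0$ and $t,u,v\ge1$ be integers with $t\le 2u\le 2t-1$, and let $N=2(2tv+1)$, $d=(2s+1)(2u+1)(4uv+2v+1)$. Let $E$ be the matrix described in (ii) with $1$, $4uv+2v+1$, $8uv-4tv+4v$, $(2s+1)(2u-t+1)$, $1$, $(2s+1)(2u+1)$ in place of $m,n,r,a,b,c$. Then $E\in E(N,d)$ and $\mathrm{Symm}_N(\delta(z,E))$ is a nonzero invariant of degree $d$ of the binary $N$-ic; its weight $w=(2s+1)(2tv+1)(2u+1)(4uv+2v+1)$ is odd, so it is a skew invariant. (v) Let $E\in E(N,d)$ have all entries strictly less than $d$ and satisfy $\mathrm{Symm}_N(\delta(z,E))\ne0$. Let $E^*$ be the $2\times2$ block matrix with diagonal blocks $0$ (of size $N-1$)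 and $E$, and with all entries of the off-diagonal blocks equal to $d$. Then $E^*\in E(2N-1,dN)$ and $\mathrm{Symm}_{2N-1}(\delta(z,E^*))$ is a nonzero invariant of degree $dN$ of the binary $(2N-1)$-ic. -/

import Mathlib

/-- The symmetrization operator `f ↦ ∑_σ f(z_{σ(1)}, …, z_{σ(N)})` on `k[z_1, …, z_N]`. -/
noncomputable def symmetrize {k : Type*} [Field k] {N : ℕ} (f : MvPolynomial (Fin N) k) :
    MvPolynomial (Fin N) k :=
  ∑ σ : Equiv.Perm (Fin N), MvPolynomial.rename σ f

/-- `E(N)`: symmetric `N × N` matrices of nonnegative integers with zero diagonal. -/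
def edgeMatrices (N : ℕ) : Set (Matrix (Fin N) (Fin N) ℕ) :=
  {A | A.IsSymm ∧ ∀ i, A i i = 0}

/-- `E(N, d)`: the members of `E(N)` all of whose row sums are equal to `d`. -/
def regularEdgeMatrices (N d : ℕ) : Set (Matrix (Fin N) (Fin N) ℕ) :=
  {A | A ∈ edgeMatrices N ∧ ∀ i, ∑ j, A i j = d}

/-- `δ(z, A) = ∏_{i < j} (z_i - z_j) ^ a_{ij}`. -/
noncomputable def graphMonomial (k : Type*) [Field k] {N : ℕ} (A : Matrix (Fin N) (Fin N) ℕ) :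
    MvPolynomial (Fin N) k :=
  ∏ i : Fin N, ∏ j ∈ Finset.Ioi i, (MvPolynomial.X i - MvPolynomial.X j) ^ A i j

/-! ### Semi-invariants and invariants of the generic binary `N`-ic

The generic binary form has leading coefficient an indeterminate `a_0` and roots `-z_1, …, -z_N`;
its coefficients are `a_i = a_0 e_i`, with `e_i` the `i`-th elementary symmetric polynomial of
`z_1, …, z_N`. The ring `k[z_1, …, z_N][a_0]` is `Polynomial (MvPolynomial (Fin N) k)`. -/

/-- `P(e_1, …, e_N)` as an element of `k[z_1, …, z_N]`; the variable of `P` with index `i : Fin N`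
stands for `e_{i+1}`. -/
noncomputable def evalElementary {k : Type*} [Field k] {N : ℕ} (P : MvPolynomial (Fin N) k) :
    MvPolynomial (Fin N) k :=
  MvPolynomial.aeval (fun i : Fin N => MvPolynomial.esymm (Fin N) k (i.val + 1)) P

/-- `E_i(t)`: the coefficient of `X ^ (N - i)` in `∏_j (X + z_j + t)`, an element of
`k[z_1, …, z_N][t]`. -/
noncomputable def shiftedElementary (k : Type*) [Field k] (N i : ℕ) :
    Polynomial (MvPolynomial (Fin N) k) :=
  (∏ j : Fin N, (Polynomial.X + Polynomial.C (Polynomial.C (MvPolynomial.X j) + Polynomial.X)) :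
    Polynomial (Polynomial (MvPolynomial (Fin N) k))).coeff (N - i)

/-- Translation invariance: `P(E_1(t), …, E_N(t)) = P(e_1, …, e_N)`. -/
def IsTranslationInvariant {k : Type*} [Field k] {N : ℕ} (P : MvPolynomial (Fin N) k) : Prop :=
  MvPolynomial.aeval (fun i : Fin N => shiftedElementary k N (i.val + 1)) P =
    Polynomial.C (evalElementary P)

/-- The substitution `k[a_0, …, a_N] → k[z_1, …, z_N][a_0]`, `a_i ↦ a_0 e_i` (with `e_0 = 1`). -/
noncomputable def evalCoefficients {k : Type*} [Field k] {N : ℕ}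
    (Q : MvPolynomial (Fin (N + 1)) k) : Polynomial (MvPolynomial (Fin N) k) :=
  MvPolynomial.aeval
    (fun i : Fin (N + 1) => Polynomial.X * Polynomial.C (MvPolynomial.esymm (Fin N) k i.val)) Q

/-- `Q ∈ k[a_0, …, a_N]` is a semi-invariant of degree `d` and weight `w` of the binary `N`-ic:
`Q = a_0 ^ d P(e_1, …, e_N)` with `P` translation invariant, of weight `w` and of total degree at
most `d`. -/
def IsSemiInvariant {k : Type*} [Field k] {N : ℕ} (d w : ℕ) (Q : MvPolynomial (Fin (N + 1)) k) :
    Prop :=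
  ∃ P : MvPolynomial (Fin N) k, IsTranslationInvariant P ∧ (evalElementary P).IsHomogeneous w ∧
    P.totalDegree ≤ d ∧ evalCoefficients Q = Polynomial.X ^ d * Polynomial.C (evalElementary P)

/-- An invariant of degree `d` and weight `w`: a semi-invariant with `w = N d / 2`. -/
def IsInvariantForm {k : Type*} [Field k] {N : ℕ} (d w : ℕ) (Q : MvPolynomial (Fin (N + 1)) k) :
    Prop :=
  IsSemiInvariant d w Q ∧ 2 * w = N * d

/-- `g ∈ k[z_1, …, z_N]`, read as the element `a_0 ^ d g` of `k[a_0, …, a_N]`, is a nonzero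
invariant of degree `d` and weight `w` of the binary `N`-ic. -/
def IsNonzeroInvariant {k : Type*} [Field k] {N : ℕ} (d w : ℕ) (g : MvPolynomial (Fin N) k) :
    Prop :=
  g ≠ 0 ∧ ∃ Q : MvPolynomial (Fin (N + 1)) k, Q ≠ 0 ∧ IsInvariantForm d w Q ∧
    evalCoefficients Q = Polynomial.X ^ d * Polynomial.C g

/-! ### The block matrices

Rows and columns are numbered from `0`. -/

/-- Entry in row `i` and column `j` of the block matrix with `m × m` blocks whose diagonal blocks
are `0` and whose off-diagonal blocks all have `2a` on the diagonal and `b` off the diagonal. -/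
def equalBlockEntry (m a b i j : ℕ) : ℕ :=
  if i / m = j / m then 0 else if i % m = j % m then 2 * a else b

/-- The matrix of `equalBlockEntry`, with `n × n` blocks of size `m × m` if `N = m n`. -/
def equalBlockMatrix (N m a b : ℕ) : Matrix (Fin N) (Fin N) ℕ :=
  Matrix.of fun i j => equalBlockEntry m a b i j

/-- For `N = 2 m n - r`: the block matrix built from the `m n × m n` matrix of `equalBlockEntry`
and a zero diagonal block of size `p = m n - r`, all entries joining the two being `c`. The block of
size `p` comes first if `p ≤ m` and last if `m < p`. -/
def extendedBlockMatrix (N m n r a b c : ℕ) : Matrix (Fin N) (Fin N) ℕ :=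
  Matrix.of fun i j =>
    if m * n - r ≤ m then
      if i.val < m * n - r ∧ j.val < m * n - r then 0
      else if i.val < m * n - r ∨ j.val < m * n - r then c
      else equalBlockEntry m a b (i.val - (m * n - r)) (j.val - (m * n - r))
    else
      if i.val < m * n ∧ j.val < m * n then equalBlockEntry m a b i j
      else if i.val < m * n ∨ j.val < m * n then c
      else 0

/-- For `N = l + m + n`: the `3 × 3` block matrix with diagonal blocks `0` of sizes `l`, `m`, `n`
and constant off-diagonal blocks, equal to `a` between the first and the second part, to `b` between
the first and the third, and to `c` between the second and the third. -/
def threeBlockMatrix (N l m a b c : ℕ) : Matrix (Fin N) (Fin N) ℕ :=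
  Matrix.of fun i j =>
    if i.val < l then
      if j.val < l then 0 else if j.val < l + m then a else b
    else if i.val < l + m then
      if j.val < l then a else if j.val < l + m then 0 else c
    else
      if j.val < l then b else if j.val < l + m then c else 0

/-- The `(2N - 1) × (2N - 1)` block matrix with diagonal blocks `0` (of size `N - 1`) and `E`, and
with constant off-diagonal blocks equal to `d`. -/
def doubledMatrix {N : ℕ} (d : ℕ) (E : Matrix (Fin N) (Fin N) ℕ) :
    Matrix (Fin (2 * N - 1)) (Fin (2 * N - 1)) ℕ :=
  Matrix.of fun i j =>
    if hi : i.val < N - 1 then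
      if j.val < N - 1 then 0 else d
    else
      if hj : j.val < N - 1 then d
      else E ⟨i.val - (N - 1), by omega⟩ ⟨j.val - (N - 1), by omega⟩

/-! The proof separates invariance from nonvanishing. Invariance is automatic for a `d`-regular
multigraph: the symmetrized product of differences is symmetric and translation invariant,
homogeneous of weight equal to the number of edges, and of degree at most `d` in each root. The
degree in one root bounds the total degree in the elementary symmetric polynomials
(`totalDegree_le_degreeOf_evalElementary`), so multiplying by `a_0 ^ d` gives a polynomial in the
coefficients. Everything thus reduces to `symmetrize (graphMonomial k A) ≠ 0`.

For nonvanishing, some roots are set equal. If two vertices are adjacent exactly when they lie in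
different parts (the first four families), one variable is assigned to each part. A term of the
symmetrization survives only if its permutation carries parts to parts. All surviving terms coincide
when the induced permutations of the parts preserve the edge counts between parts and reverse only
pairs with an even count. The result is a nonzero product times the order of a subgroup of `S_N`,
which is nonzero in `k` (`symmetrize_graphMonomial_ne_zero`).

For the doubled matrix only the `N - 1` new roots are identified. Entries smaller than `d` force
every surviving permutation to preserve the two blocks (`isLeft_of_independent`), and the sum
factors as `(N - 1)!` times a nonzero product times the symmetrization for `E`. -/

/-! ### Symmetrized monomials of regular multigraphs as invariants. -/

open MvPolynomial in
/-- The total degree of `P` is at most the degree of `P(e_1, …, e_N)` in the first variable: the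
lexicographically leading exponent of `∏ e_i ^ t_i` has first entry `∑ t_i`. -/
theorem totalDegree_le_degreeOf_evalElementary {k : Type*} [Field k] {N : ℕ} [NeZero N]
    (P : MvPolynomial (Fin N) k) :
    P.totalDegree ≤ (evalElementary P).degreeOf 0 := by
  classical
  by_cases hP : P = 0
  · simp [hP]
  have key : evalElementary P =
      ∑ t ∈ P.support, esymmAlgHomMonomial (Fin N) t (P.coeff t) := by
    conv_lhs => rw [P.as_sum]
    simp only [evalElementary, map_sum, esymmAlgHomMonomial, esymmAlgHom_apply]
  -- The lex-leading exponent of `∏ e_i ^ t_i` is the sequence of tail sums of `t`; its first entry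
  -- is `∑ t_i`, and it determines `t`. Hence the largest leading term cannot cancel.
  have hsup : ∀ t ∈ P.support, ofLex (AddMonoidAlgebra.supDegree toLex
      (esymmAlgHomMonomial (Fin N) t (P.coeff t))) = Fin.accumulate N N t := fun t ht =>
    supDegree_esymmAlgHomMonomial (mem_support_iff.1 ht) t le_rfl
  obtain ⟨t, ht, hmax⟩ := Finset.exists_max_image P.support
    (fun t => AddMonoidAlgebra.supDegree toLex (esymmAlgHomMonomial (Fin N) t (P.coeff t)))
    (support_nonempty.2 hP)
  have hlt : ∀ s ∈ P.support, s ≠ t → AddMonoidAlgebra.supDegree toLex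
      (esymmAlgHomMonomial (Fin N) s (P.coeff s)) < AddMonoidAlgebra.supDegree toLex
      (esymmAlgHomMonomial (Fin N) t (P.coeff t)) := by
    intro s hs hst
    refine lt_of_le_of_ne (hmax s hs) fun h => hst ?_
    refine DFunLike.ext' (Fin.accumulate_injective le_rfl ?_)
    rw [← hsup s hs, ← hsup t ht, h]
  have hlead := AddMonoidAlgebra.supDegree_leadingCoeff_sum_eq (D := toLex) ht hlt
  rw [← key] at hlead
  have hne : evalElementary P ≠ 0 := by
    intro h
    have h2 := hlead.2
    rw [leadingCoeff_esymmAlgHomMonomial _ le_rfl, h] at h2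
    simp at h2
    exact mem_support_iff.1 ht h2.symm
  obtain ⟨u, hu, hdeg⟩ := AddMonoidAlgebra.exists_supDegree_mem_support toLex hne
  have hacc : ∀ s : Fin N →₀ ℕ, Fin.accumulate N N s 0 = ∑ i, s i := fun s => by
    simp [Fin.accumulate_apply]
  have hut : u 0 = ∑ i, t i := by
    rw [← hacc, ← hsup t ht, ← hlead.1, hdeg, ofLex_toLex]
  refine le_trans ?_ (hut ▸ monomial_le_degreeOf 0 hu)
  rw [totalDegree]
  refine Finset.sup_le fun s hs => ?_
  rw [Finsupp.sum_fintype _ _ fun _ => rfl, ← hacc, ← hacc, ← hsup s hs, ← hsup t ht]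
  obtain h | h := (hmax s hs).eq_or_lt
  · exact (congrArg (fun x : Lex (Fin N →₀ ℕ) => ofLex x 0) h).le
  -- A lexicographically smaller exponent either has a smaller first entry or agrees there.
  · obtain ⟨i, hi, hlt⟩ := Finsupp.Lex.lt_iff.1 h
    obtain rfl | h0 := eq_or_ne i 0
    · exact hlt.le
    · exact (hi 0 (Fin.pos_iff_ne_zero.2 h0)).le

open MvPolynomial in
theorem exists_evalElementary_eq {k : Type*} [Field k] {N : ℕ} [NeZero N]
    {g : MvPolynomial (Fin N) k} (hg : g.IsSymmetric) {d : ℕ} (hd : g.degreeOf 0 ≤ d) :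
    ∃ P : MvPolynomial (Fin N) k, evalElementary P = g ∧ P.totalDegree ≤ d := by
  obtain ⟨P, hP⟩ := esymmAlgHom_fin_surjective k (le_refl N) ⟨g, hg⟩
  have h : evalElementary P = g := by
    rw [evalElementary, ← esymmAlgHom_apply, hP]
  exact ⟨P, h, (totalDegree_le_degreeOf_evalElementary P).trans (h ▸ hd)⟩

/-- The translation `z_i ↦ z_i + t`. -/
noncomputable def translateRoots (k : Type*) [Field k] (N : ℕ) :
    MvPolynomial (Fin N) k →ₐ[k] Polynomial (MvPolynomial (Fin N) k) :=
  MvPolynomial.aeval fun j => Polynomial.C (MvPolynomial.X j) + Polynomial.X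

theorem translate_esymm (k : Type*) [Field k] {N : ℕ} {i : ℕ} (hi : i ≤ N) :
    translateRoots k N (MvPolynomial.esymm (Fin N) k i) = shiftedElementary k N i := by
  rw [shiftedElementary, Finset.prod_X_add_C_coeff _ _ (by simp), translateRoots,
    MvPolynomial.aeval_esymm_eq_multiset_esymm, Finset.esymm_map_val]
  simp [Nat.sub_sub_self hi]

/-- By `translate_esymm`, substituting the shifted elementary polynomials is the same as translating
the roots, so only the value of `P` at the `e_i` matters. -/
theorem isTranslationInvariant_of_translate {k : Type*} [Field k] {N : ℕ}
    {P : MvPolynomial (Fin N) k}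
    (h : translateRoots k N (evalElementary P) = Polynomial.C (evalElementary P)) :
    IsTranslationInvariant P := by
  rw [IsTranslationInvariant, ← h, evalElementary]
  rw [← AlgHom.comp_apply, MvPolynomial.comp_aeval]
  congr 2
  ext1 i
  rw [translate_esymm k i.2]

theorem translate_rename_graphMonomial (k : Type*) [Field k] {N : ℕ}
    (A : Matrix (Fin N) (Fin N) ℕ) (σ : Equiv.Perm (Fin N)) :
    translateRoots k N (MvPolynomial.rename σ (graphMonomial k A)) =
      Polynomial.C (MvPolynomial.rename σ (graphMonomial k A)) := by
  simp [graphMonomial, translateRoots, map_prod]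

theorem translate_symmetrize_graphMonomial (k : Type*) [Field k] {N : ℕ}
    (A : Matrix (Fin N) (Fin N) ℕ) :
    translateRoots k N (symmetrize (graphMonomial k A)) =
      Polynomial.C (symmetrize (graphMonomial k A)) := by
  simp only [symmetrize, map_sum, translate_rename_graphMonomial]

theorem symmetrize_isSymmetric {k : Type*} [Field k] {N : ℕ} (f : MvPolynomial (Fin N) k) :
    (symmetrize f).IsSymmetric := by
  intro τ
  simp only [symmetrize, map_sum, MvPolynomial.rename_rename]
  exact Fintype.sum_equiv (Equiv.mulLeft τ) _ _ fun σ => rfl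

/-- Handshake count: each edge contributes to two row sums. -/
theorem sum_sum_Ioi {N : ℕ} {A : Matrix (Fin N) (Fin N) ℕ} (hA : A ∈ edgeMatrices N) :
    2 * ∑ i, ∑ j ∈ Finset.Ioi i, A i j = ∑ i, ∑ j, A i j := by
  have h := Finset.sum_sum_Ioi_add_eq_sum_sum_off_diag (fun i j => A j i)
  have h2 : ∀ i, ∑ j ∈ {i}ᶜ, A i j = ∑ j, A i j := fun i => by
    rw [← Finset.sum_compl_add_sum {i}, Finset.sum_singleton, hA.2 i, add_zero]
  simp only [h2] at h
  rw [← h, Finset.mul_sum]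
  refine Finset.sum_congr rfl fun i _ => ?_
  rw [Finset.mul_sum]
  refine Finset.sum_congr rfl fun j _ => ?_
  rw [hA.1.apply, two_mul]

theorem graphMonomial_isHomogeneous (k : Type*) [Field k] {N d w : ℕ}
    {A : Matrix (Fin N) (Fin N) ℕ} (hA : A ∈ regularEdgeMatrices N d) (hw : 2 * w = N * d) :
    (graphMonomial k A).IsHomogeneous w := by
  have h := sum_sum_Ioi hA.1
  simp only [hA.2, Finset.sum_const, Finset.card_univ, Fintype.card_fin, smul_eq_mul] at h
  obtain rfl : w = ∑ i, ∑ j ∈ Finset.Ioi i, A i j := by omega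
  refine MvPolynomial.IsHomogeneous.prod _ _ _ fun i _ =>
    MvPolynomial.IsHomogeneous.prod _ _ _ fun j _ => ?_
  have := ((MvPolynomial.isHomogeneous_X k i).sub (MvPolynomial.isHomogeneous_X k j)).pow (A i j)
  rwa [one_mul] at this

theorem degreeOf_graphMonomial_le (k : Type*) [Field k] {N d : ℕ}
    {A : Matrix (Fin N) (Fin N) ℕ} (hA : A ∈ regularEdgeMatrices N d) (l : Fin N) :
    (graphMonomial k A).degreeOf l ≤ d := by
  classical
  -- Only edges at `l` involve the variable `l`; keeping just the row of `l` makes the sum over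
  -- ordered pairs count each such edge once.
  have h := Finset.sum_sum_Ioi_add_eq_sum_sum_off_diag (fun i j => if j = l then A j i else 0)
  have h2 : ∑ i, ∑ j ∈ {i}ᶜ, (if i = l then A i j else 0) ≤ d := by
    rw [← hA.2 l, Finset.sum_eq_single l]
    · simp only [if_true]
      exact Finset.sum_le_sum_of_subset (Finset.subset_univ _)
    · intro b _ hb
      simp [hb]
    · simp
  refine le_trans ?_ (h.trans_le h2)
  refine (MvPolynomial.degreeOf_prod_le _ _ _).trans (Finset.sum_le_sum fun i _ => ?_)
  refine (MvPolynomial.degreeOf_prod_le _ _ _).trans (Finset.sum_le_sum fun j _ => ?_)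
  refine (MvPolynomial.degreeOf_pow_le _ _ _).trans ?_
  have h3 : (MvPolynomial.X i - MvPolynomial.X j : MvPolynomial (Fin N) k).degreeOf l ≤
      (if i = l then 1 else 0) + (if j = l then 1 else 0) := by
    refine (MvPolynomial.degreeOf_sub_le _ _ _).trans ?_
    rw [MvPolynomial.degreeOf_X, MvPolynomial.degreeOf_X]
    simp only [eq_comm (a := l)]
    exact max_le (Nat.le_add_right _ _) (Nat.le_add_left _ _)
  refine (Nat.mul_le_mul_left _ h3).trans (le_of_eq ?_)
  rw [hA.1.1.apply i j, mul_add]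
  simp

theorem degreeOf_symmetrize_graphMonomial_le (k : Type*) [Field k] {N d : ℕ}
    {A : Matrix (Fin N) (Fin N) ℕ} (hA : A ∈ regularEdgeMatrices N d) (l : Fin N) :
    (symmetrize (graphMonomial k A)).degreeOf l ≤ d := by
  refine (MvPolynomial.degreeOf_sum_le _ _ _).trans (Finset.sup_le fun σ _ => ?_)
  rw [← σ.apply_symm_apply l, MvPolynomial.degreeOf_rename_of_injective σ.injective]
  exact degreeOf_graphMonomial_le k hA _

theorem exists_evalCoefficients_eq {k : Type*} [Field k] {N d : ℕ} (P : MvPolynomial (Fin N) k)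
    (hP : P.totalDegree ≤ d) :
    ∃ Q : MvPolynomial (Fin (N + 1)) k,
      evalCoefficients Q = Polynomial.X ^ d * Polynomial.C (evalElementary P) := by
  -- Homogenization by `a_0`: the bound on the total degree makes `d - ∑ t_i` a true difference.
  refine ⟨∑ t ∈ P.support, MvPolynomial.C (P.coeff t) * (MvPolynomial.X 0 ^ (d - ∑ i, t i) *
    ∏ i, MvPolynomial.X i.succ ^ t i), ?_⟩
  have h : evalElementary P = ∑ t ∈ P.support,
      MvPolynomial.C (P.coeff t) * ∏ i : Fin N, MvPolynomial.esymm (Fin N) k (i.val + 1) ^ t i := by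
    rw [evalElementary, MvPolynomial.aeval_def, MvPolynomial.eval₂_eq']
    rfl
  rw [h, map_sum, Finset.mul_sum, evalCoefficients, map_sum]
  refine Finset.sum_congr rfl fun t ht => ?_
  have hd : ∑ i, t i ≤ d := by
    refine le_trans ?_ hP
    have := MvPolynomial.le_totalDegree ht
    rwa [Finsupp.sum_fintype _ _ fun _ => rfl] at this
  simp only [map_mul, map_pow, map_prod, MvPolynomial.aeval_X, MvPolynomial.algHom_C, Fin.val_zero,
    MvPolynomial.esymm_zero, map_one, mul_one, Fin.val_succ, mul_pow, Finset.prod_mul_distrib,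
    Finset.prod_pow_eq_pow_sum]
  rw [← Nat.sub_add_cancel hd, pow_add, Nat.add_sub_cancel]
  rw [show algebraMap k (Polynomial (MvPolynomial (Fin N) k)) (P.coeff t) =
    Polynomial.C (MvPolynomial.C (P.coeff t)) from rfl]
  ring

/-- A nonzero symmetrized graph monomial of a regular multigraph is an invariant. -/
theorem isNonzeroInvariant_symmetrize_graphMonomial {k : Type*} [Field k] {N d w : ℕ} [NeZero N]
    {A : Matrix (Fin N) (Fin N) ℕ} (hA : A ∈ regularEdgeMatrices N d) (hw : 2 * w = N * d)
    (h : symmetrize (graphMonomial k A) ≠ 0) :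
    IsNonzeroInvariant d w (symmetrize (graphMonomial k A)) := by
  obtain ⟨P, hP, hPd⟩ := exists_evalElementary_eq (symmetrize_isSymmetric (graphMonomial k A))
    (degreeOf_symmetrize_graphMonomial_le k hA 0)
  obtain ⟨Q, hQ⟩ := exists_evalCoefficients_eq P hPd
  refine ⟨h, Q, ?_, ⟨⟨P, ?_, ?_, hPd, hQ⟩, hw⟩, hP ▸ hQ⟩
  · rintro rfl
    rw [hP, evalCoefficients, map_zero] at hQ
    exact mul_ne_zero (pow_ne_zero _ Polynomial.X_ne_zero) (Polynomial.C_ne_zero.2 h) hQ.symm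
  · apply isTranslationInvariant_of_translate
    rw [hP, translate_symmetrize_graphMonomial]
  · rw [hP]
    exact MvPolynomial.IsHomogeneous.sum _ _ _ fun σ _ =>
      (graphMonomial_isHomogeneous k hA hw).rename_isHomogeneous

theorem exists_isNonzeroInvariant_symmetrize_graphMonomial {k : Type*} [Field k] {N d : ℕ}
    [NeZero N] {A : Matrix (Fin N) (Fin N) ℕ} (hA : A ∈ regularEdgeMatrices N d)
    (h : symmetrize (graphMonomial k A) ≠ 0) :
    ∃ w, IsNonzeroInvariant d w (symmetrize (graphMonomial k A)) := by
  -- The weight is the number of edges.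
  refine ⟨∑ i, ∑ j ∈ Finset.Ioi i, A i j, isNonzeroInvariant_symmetrize_graphMonomial hA ?_ h⟩
  rw [sum_sum_Ioi hA.1]
  simp [hA.2]

/-! ### Nonvanishing when the support is complete multipartite. -/

/-- A permutation of `κ` permutes unordered pairs; each is represented here by its increasing
ordering. -/
theorem prod_lt_comp_perm {κ M : Type*} [LinearOrder κ] [Fintype κ] [CommMonoid M]
    (g : κ → κ → M) (hg : ∀ p q, g p q = g q p) (π : Equiv.Perm κ) :
    ∏ x : κ × κ with x.1 < x.2, g (π x.1) (π x.2) = ∏ x : κ × κ with x.1 < x.2, g x.1 x.2 := by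
  have hmaps : ∀ ρ : Equiv.Perm κ, ∀ x ∈ ({x : κ × κ | x.1 < x.2} : Finset (κ × κ)),
      (if ρ x.1 < ρ x.2 then (ρ x.1, ρ x.2) else (ρ x.2, ρ x.1)) ∈
        ({x : κ × κ | x.1 < x.2} : Finset (κ × κ)) := by
    intro ρ x hx
    rw [Finset.mem_filter_univ] at hx ⊢
    split_ifs with h
    · exact h
    · exact lt_of_le_of_ne (not_lt.1 h) (ρ.injective.ne hx.ne')
  have hinv : ∀ ρ : Equiv.Perm κ, ∀ x ∈ ({x : κ × κ | x.1 < x.2} : Finset (κ × κ)),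
      (fun y : κ × κ => if ρ.symm y.1 < ρ.symm y.2 then (ρ.symm y.1, ρ.symm y.2)
        else (ρ.symm y.2, ρ.symm y.1))
        (if ρ x.1 < ρ x.2 then (ρ x.1, ρ x.2) else (ρ x.2, ρ x.1)) = x := by
    intro ρ x hx
    rw [Finset.mem_filter_univ] at hx
    split_ifs <;> simp [hx, hx.not_gt]
  refine Finset.prod_bij'
    (fun x _ => if π x.1 < π x.2 then (π x.1, π x.2) else (π x.2, π x.1))
    (fun x _ => if π.symm x.1 < π.symm x.2 then (π.symm x.1, π.symm x.2)
      else (π.symm x.2, π.symm x.1)) (hmaps π) (hmaps π.symm) (hinv π) (hinv π.symm) ?_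
  intro x _
  split_ifs
  · rfl
  · exact hg _ _

/-- The total number of edges between two colour classes. -/
def colorWeight {N : ℕ} {κ : Type*} [DecidableEq κ] (A : Matrix (Fin N) (Fin N) ℕ)
    (c : Fin N → κ) (p q : κ) : ℕ :=
  ∑ i, ∑ j, if c i = p ∧ c j = q then A i j else 0

theorem colorWeight_comm {N : ℕ} {κ : Type*} [DecidableEq κ] {A : Matrix (Fin N) (Fin N) ℕ}
    (hA : A.IsSymm) (c : Fin N → κ) (p q : κ) : colorWeight A c p q = colorWeight A c q p := by
  rw [colorWeight, Finset.sum_comm]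
  refine Finset.sum_congr rfl fun i _ => Finset.sum_congr rfl fun j _ => ?_
  simp only [hA.apply i j, and_comm]

/-- Collecting the factors by pairs of parts produces a sign that depends on `A` and `c` but not on
`y`. The same sign therefore occurs for `y` and for `y` composed with a permutation of the parts. -/
theorem prod_sub_pow_eq_colorWeight {N : ℕ} {κ R : Type*} [LinearOrder κ] [Fintype κ] [CommRing R]
    {A : Matrix (Fin N) (Fin N) ℕ} (hA : A.IsSymm) {c : Fin N → κ}
    (hc : ∀ i j, c i = c j → A i j = 0) (y : κ → R) :
    ∏ i, ∏ j ∈ Finset.Ioi i, (y (c i) - y (c j)) ^ A i j =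
      (∏ i, ∏ j ∈ Finset.Ioi i, if c j < c i then (-1) ^ A i j else 1) *
        ∏ x : κ × κ with x.1 < x.2, (y x.1 - y x.2) ^ colorWeight A c x.1 x.2 := by
  have h1 : ∏ x : κ × κ with x.1 < x.2, (y x.1 - y x.2) ^ colorWeight A c x.1 x.2 =
      ∏ i, ∏ j, if c i < c j then (y (c i) - y (c j)) ^ A i j else 1 := by
    simp only [colorWeight, ← Finset.prod_pow_eq_pow_sum]
    rw [Finset.prod_comm]
    refine Finset.prod_congr rfl fun i _ => ?_
    rw [Finset.prod_comm]
    refine Finset.prod_congr rfl fun j _ => ?_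
    split_ifs with h
    · rw [Finset.prod_eq_single (c i, c j)]
      · simp
      · rintro ⟨p, q⟩ _ hne
        rw [if_neg, pow_zero]
        rintro ⟨rfl, rfl⟩
        exact hne rfl
      · intro h2
        exact absurd h (by simpa using h2)
    · refine Finset.prod_eq_one fun x hx => ?_
      rw [Finset.mem_filter_univ] at hx
      rw [if_neg, pow_zero]
      rintro ⟨h1, h2⟩
      exact h (h1 ▸ h2 ▸ hx)
  have h2 : ∀ i, ∏ j, (if c i < c j then (y (c i) - y (c j)) ^ A i j else 1) =
      ∏ j ∈ {i}ᶜ, if c i < c j then (y (c i) - y (c j)) ^ A i j else 1 := fun i => by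
    rw [← Finset.prod_compl_mul_prod {i}]
    simp
  have h3 := Finset.prod_prod_Ioi_mul_eq_prod_prod_off_diag
    (fun j i => if c i < c j then (y (c i) - y (c j)) ^ A i j else 1)
  simp only [h1, h2]
  rw [← h3, ← Finset.prod_mul_distrib]
  refine Finset.prod_congr rfl fun i _ => ?_
  rw [← Finset.prod_mul_distrib]
  refine Finset.prod_congr rfl fun j _ => ?_
  obtain h | h | h := lt_trichotomy (c i) (c j)
  · simp [h, h.not_gt]
  · simp [h, hc i j h]
  · rw [if_pos h, if_neg h.not_gt, if_pos h, hA.apply i j, one_mul, ← mul_pow]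
    ring

/-- The pairs `S` are the preimage of the pairs `T` under the bijection `σ × σ`, so the inclusion `S
⊆ T` is an equality by cardinality. -/
theorem comp_perm_eq_iff {N : ℕ} {κ : Type*} [DecidableEq κ] {c : Fin N → κ}
    {σ : Equiv.Perm (Fin N)} (h : ∀ i j, c (σ i) = c (σ j) → c i = c j) (i j : Fin N) :
    c (σ i) = c (σ j) ↔ c i = c j := by
  refine ⟨h i j, fun hij => ?_⟩
  let S : Finset (Fin N × Fin N) := {x | c (σ x.1) = c (σ x.2)}
  let T : Finset (Fin N × Fin N) := {x | c x.1 = c x.2}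
  have hST : S ⊆ T := fun x hx => by
    simp only [S, T, Finset.mem_filter_univ] at hx ⊢
    exact h _ _ hx
  have hcard : T.card ≤ S.card := by
    refine Finset.card_le_card_of_injOn (fun x => (σ.symm x.1, σ.symm x.2)) (fun x hx => ?_)
      (fun x _ y _ hxy => ?_)
    · simpa [S, T] using hx
    · simpa [Prod.ext_iff] using hxy
  have : (i, j) ∈ S := by
    rw [Finset.eq_of_subset_of_card_le hST hcard]
    simpa [T] using hij
  simpa [S] using this

/-- The group of permutations that preserve a partition into colour classes. -/
def colorSubgroup {N : ℕ} {κ : Type*} (c : Fin N → κ) : Subgroup (Equiv.Perm (Fin N)) where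
  carrier := {σ | ∀ i j, c (σ i) = c (σ j) ↔ c i = c j}
  one_mem' := fun _ _ => Iff.rfl
  mul_mem' := fun {σ τ} hσ hτ i j => (hσ (τ i) (τ j)).trans (hτ i j)
  inv_mem' := fun {σ} hσ i j => by
    have := hσ (σ⁻¹ i) (σ⁻¹ j)
    simpa using this.symm

theorem exists_color_perm {N : ℕ} {κ : Type*} [DecidableEq κ] [Finite κ] {c : Fin N → κ}
    (hc : Function.Surjective c) {σ : Equiv.Perm (Fin N)} (hσ : σ ∈ colorSubgroup c) :
    ∃ π : Equiv.Perm κ, (∀ i, c (σ i) = π (c i)) ∧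
      ∀ p, Fintype.card {i // c i = π p} = Fintype.card {i // c i = p} := by
  choose s hs using hc
  have hinj : Function.Injective fun p => c (σ (s p)) := fun p q hpq => by
    rw [← hs p, ← hs q]
    exact (hσ _ _).1 hpq
  have hπ : ∀ i, c (σ i) = c (σ (s (c i))) := fun i => (hσ _ _).2 (hs _).symm
  let π : Equiv.Perm κ := Equiv.ofBijective _ (Finite.injective_iff_bijective.1 hinj)
  have hπ' : ∀ i, c (σ i) = π (c i) := hπ
  refine ⟨π, hπ', fun p => Fintype.card_congr (σ.subtypeEquiv fun i => ?_).symm⟩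
  rw [hπ', π.injective.eq_iff]

/-- Nonvanishing of the symmetrization for a complete multipartite support: identify the variables
within each part. -/
theorem symmetrize_graphMonomial_ne_zero {k : Type*} [Field k] {N : ℕ}
    (hN : (N.factorial : k) ≠ 0) {κ : Type*} [LinearOrder κ] [Fintype κ]
    {A : Matrix (Fin N) (Fin N) ℕ} (hA : A.IsSymm) {c : Fin N → κ}
    (hc : ∀ i j, A i j = 0 ↔ c i = c j) (hsurj : Function.Surjective c)
    (hW : ∀ π : Equiv.Perm κ,
      (∀ p, Fintype.card {i // c i = π p} = Fintype.card {i // c i = p}) →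
      ∀ p q, p < q → colorWeight A c (π p) (π q) = colorWeight A c p q ∧
        (π q < π p → Even (colorWeight A c p q))) :
    symmetrize (graphMonomial k A) ≠ 0 := by
  classical
  let φ : MvPolynomial (Fin N) k →ₐ[k] MvPolynomial κ k :=
    MvPolynomial.aeval fun i => MvPolynomial.X (c i)
  have hφ : ∀ σ : Equiv.Perm (Fin N), φ (MvPolynomial.rename σ (graphMonomial k A)) =
      ∏ i, ∏ j ∈ Finset.Ioi i,
        (MvPolynomial.X (c (σ i)) - MvPolynomial.X (c (σ j))) ^ A i j := fun σ => by
    simp [φ, graphMonomial, map_prod]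
  have hzero : ∀ σ : Equiv.Perm (Fin N), σ ∉ colorSubgroup c →
      φ (MvPolynomial.rename σ (graphMonomial k A)) = 0 := by
    intro σ hσ
    -- Some pair from different parts is sent into one part; its exponent is positive because the
    -- support is complete multipartite, so its factor becomes zero.
    obtain ⟨i, j, hij, hne⟩ : ∃ i j, c (σ i) = c (σ j) ∧ c i ≠ c j := by
      by_contra! h
      exact hσ fun i j => comp_perm_eq_iff h i j
    wlog hlt : i < j generalizing i j
    · exact this j i hij.symm hne.symm (lt_of_le_of_ne (not_lt.1 hlt) fun h => hne (h ▸ rfl))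
    rw [hφ]
    refine Finset.prod_eq_zero (Finset.mem_univ i)
      (Finset.prod_eq_zero (Finset.mem_Ioi.2 hlt) ?_)
    rw [hij, sub_self, zero_pow (mt (hc i j).1 hne)]
  have hconst : ∀ σ ∈ colorSubgroup c, φ (MvPolynomial.rename σ (graphMonomial k A)) =
      ∏ i, ∏ j ∈ Finset.Ioi i, (MvPolynomial.X (c i) - MvPolynomial.X (c j)) ^ A i j := by
    intro σ hσ
    obtain ⟨π, hπ, hcard⟩ := exists_color_perm hsurj hσ
    rw [hφ]
    simp only [hπ]
    rw [prod_sub_pow_eq_colorWeight hA (fun i j => (hc i j).2)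
        (fun p => (MvPolynomial.X (π p) : MvPolynomial κ k)),
      prod_sub_pow_eq_colorWeight hA (fun i j => (hc i j).2)
        (fun p => (MvPolynomial.X p : MvPolynomial κ k))]
    congr 1
    -- Each factor is written in increasing orientation, which makes `g` symmetric; where `π`
    -- reverses a pair, the sign disappears because the exponent is even.
    let g : κ → κ → MvPolynomial κ k := fun p q =>
      if p < q then (MvPolynomial.X p - MvPolynomial.X q) ^ colorWeight A c p q
      else (MvPolynomial.X q - MvPolynomial.X p) ^ colorWeight A c q p
    have hg : ∀ p q, g p q = g q p := fun p q => by
      obtain h | rfl | h := lt_trichotomy p q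
      · simp [g, h, h.not_gt]
      · rfl
      · simp [g, h, h.not_gt]
    have hg' : ∀ p q, p < q →
        g p q = (MvPolynomial.X p - MvPolynomial.X q) ^ colorWeight A c p q := fun p q h => if_pos h
    trans ∏ x : κ × κ with x.1 < x.2, g (π x.1) (π x.2)
    · refine Finset.prod_congr rfl fun x hx => ?_
      rw [Finset.mem_filter_univ] at hx
      obtain ⟨h1, h2⟩ := hW π hcard _ _ hx
      obtain h | h | h := lt_trichotomy (π x.1) (π x.2)
      · rw [hg' _ _ h, h1]
      · exact absurd (π.injective h) hx.ne
      · rw [hg, hg' _ _ h, colorWeight_comm hA _ (π x.2), h1, ← neg_sub, (h2 h).neg_pow]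
    · rw [prod_lt_comp_perm g hg]
      refine Finset.prod_congr rfl fun x hx => hg' _ _ ?_
      simpa using hx
  have hsum : φ (symmetrize (graphMonomial k A)) = (Nat.card (colorSubgroup c) : MvPolynomial κ k) *
      ∏ i, ∏ j ∈ Finset.Ioi i, (MvPolynomial.X (c i) - MvPolynomial.X (c j)) ^ A i j := by
    rw [symmetrize, map_sum, ← Finset.sum_filter_add_sum_filter_not _ (· ∈ colorSubgroup c),
      Finset.sum_congr rfl fun σ hσ => hconst σ (Finset.mem_filter.1 hσ).2,
      Finset.sum_congr (g := fun _ => 0) rfl fun σ hσ => hzero σ (Finset.mem_filter.1 hσ).2,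
      Finset.sum_const, Finset.sum_const_zero, add_zero, nsmul_eq_mul, Nat.card_eq_fintype_card,
      Fintype.card_subtype]
  intro h0
  rw [h0, map_zero] at hsum
  refine mul_ne_zero ?_ ?_ hsum.symm
  -- By Lagrange the number of surviving terms divides `N!`.
  · have hdvd := Subgroup.card_subgroup_dvd_card (colorSubgroup c)
    rw [Nat.card_perm, Nat.card_fin] at hdvd
    obtain ⟨r, hr⟩ := hdvd
    intro h
    apply hN
    have : (N.factorial : MvPolynomial κ k) = 0 := by rw [hr, Nat.cast_mul, h, zero_mul]
    exact MvPolynomial.C_injective κ k (by simpa using this)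
  · refine Finset.prod_ne_zero_iff.2 fun i _ => Finset.prod_ne_zero_iff.2 fun j _ => ?_
    by_cases hij : c i = c j
    · rw [(hc i j).2 hij, pow_zero]
      exact one_ne_zero
    · exact pow_ne_zero _ (sub_ne_zero.2 fun h => hij (MvPolynomial.X_injective h))

theorem mem_regularEdgeMatrices_of_equiv {N d : ℕ} {V : Type*} [Fintype V] (e : V ≃ Fin N)
    {A : Matrix (Fin N) (Fin N) ℕ} {A' : V → V → ℕ} (he : ∀ x y, A (e x) (e y) = A' x y)
    (hsymm : ∀ x y, A' x y = A' y x) (hdiag : ∀ x, A' x x = 0) (hd : ∀ x, ∑ y, A' x y = d) :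
    A ∈ regularEdgeMatrices N d := by
  refine ⟨⟨Matrix.IsSymm.ext fun i j => ?_, fun i => ?_⟩, fun i => ?_⟩
  · obtain ⟨x, rfl⟩ := e.surjective i
    obtain ⟨y, rfl⟩ := e.surjective j
    rw [he, he, hsymm]
  · obtain ⟨x, rfl⟩ := e.surjective i
    rw [he, hdiag]
  · obtain ⟨x, rfl⟩ := e.surjective i
    rw [← e.sum_comp, ← hd x]
    simp only [he]

/-- The criterion for a structured vertex set `V`, with part sizes `s` and edge counts `W` supplied
explicitly. The numbering `e` need not respect the order of the parts. -/
theorem symmetrize_graphMonomial_ne_zero_of_equiv {k : Type*} [Field k] {N : ℕ}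
    (hN : (N.factorial : k) ≠ 0) {V κ : Type*} [Fintype V] [LinearOrder κ] [Fintype κ]
    (e : V ≃ Fin N) {A : Matrix (Fin N) (Fin N) ℕ} {A' : V → V → ℕ}
    (he : ∀ x y, A (e x) (e y) = A' x y) (hsymm : ∀ x y, A' x y = A' y x) {c : V → κ}
    (hc : ∀ x y, A' x y = 0 ↔ c x = c y) (hsurj : Function.Surjective c) (s : κ → ℕ)
    (hs : ∀ p, ∑ x, (if c x = p then 1 else 0) = s p) (W : κ → κ → ℕ)
    (hW : ∀ p q, p ≠ q → ∑ x, ∑ y, (if c x = p ∧ c y = q then A' x y else 0) = W p q)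
    (hπ : ∀ π : Equiv.Perm κ, (∀ p, s (π p) = s p) →
      ∀ p q, p < q → W (π p) (π q) = W p q ∧ (π q < π p → Even (W p q))) :
    symmetrize (graphMonomial k A) ≠ 0 := by
  classical
  have hcard : ∀ p, Fintype.card {i // c (e.symm i) = p} = s p := fun p => by
    rw [Fintype.card_subtype, Finset.card_filter, ← hs, ← e.sum_comp]
    simp
  have hweight : ∀ p q, p ≠ q → colorWeight A (c ∘ e.symm) p q = W p q := fun p q hpq => by
    rw [colorWeight, ← hW p q hpq, ← e.sum_comp]
    refine Finset.sum_congr rfl fun x _ => ?_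
    rw [← e.sum_comp]
    simp [he]
  refine symmetrize_graphMonomial_ne_zero hN (κ := κ) (c := c ∘ e.symm)
    (Matrix.IsSymm.ext fun i j => ?_) (fun i j => ?_) (hsurj.comp e.symm.surjective)
    fun π hcardπ p q hpq => ?_
  · rw [← e.apply_symm_apply i, ← e.apply_symm_apply j, he, he, hsymm]
  · conv_lhs => rw [← e.apply_symm_apply i, ← e.apply_symm_apply j, he]
    exact hc _ _
  · rw [hweight _ _ (π.injective.ne hpq.ne), hweight _ _ hpq.ne]
    refine hπ π (fun p => ?_) p q hpq
    rw [← hcard, ← hcard]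
    exact hcardπ p

/-! ### Equal blocks. -/

theorem sum_ite_eq_add_mul (m x y : ℕ) (u : Fin m) :
    ∑ v : Fin m, (if u = v then x else y) = x + (m - 1) * y := by
  rw [← Finset.add_sum_erase _ _ (Finset.mem_univ u), if_pos rfl,
    Finset.sum_congr rfl fun v hv => if_neg (Finset.ne_of_mem_erase hv).symm]
  simp

theorem sum_ite_fst_eq {n : ℕ} (m t : ℕ) (q : Fin n) :
    ∑ x : Fin n × Fin m, (if x.1 = q then t else 0) = m * t := by
  rw [Fintype.sum_prod_type, Finset.sum_comm]
  simp

/-- The adjacency of the equal-block matrix, vertices being pairs (block, position). -/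
def equalBlock {m n : ℕ} (a b : ℕ) (x y : Fin n × Fin m) : ℕ :=
  if x.1 = y.1 then 0 else if x.2 = y.2 then 2 * a else b

theorem equalBlock_comm {m n : ℕ} (a b : ℕ) (x y : Fin n × Fin m) :
    equalBlock a b x y = equalBlock a b y x := by
  simp only [equalBlock, eq_comm]

theorem equalBlock_eq_zero_iff {m n a b : ℕ} (ha : 0 < a) (hb : 0 < b) (x y : Fin n × Fin m) :
    equalBlock a b x y = 0 ↔ x.1 = y.1 := by
  rw [equalBlock]
  split_ifs <;> simp [*, ha.ne', hb.ne']

theorem sum_equalBlock_right {m n : ℕ} (a b : ℕ) (x : Fin n × Fin m) (q : Fin n) :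
    ∑ v, equalBlock a b x (q, v) = if x.1 = q then 0 else 2 * a + (m - 1) * b := by
  simp only [equalBlock]
  split_ifs
  · simp
  · exact sum_ite_eq_add_mul _ _ _ _

theorem sum_equalBlock {m n : ℕ} (a b : ℕ) (x : Fin n × Fin m) :
    ∑ y, equalBlock a b x y = (n - 1) * (2 * a + (m - 1) * b) := by
  rw [Fintype.sum_prod_type]
  simp only [sum_equalBlock_right]
  rw [sum_ite_eq_add_mul, zero_add]

theorem sum_equalBlock_blocks {m n : ℕ} (a b : ℕ) {p q : Fin n} (hpq : p ≠ q) :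
    ∑ x : Fin n × Fin m, ∑ y : Fin n × Fin m,
      (if x.1 = p ∧ y.1 = q then equalBlock a b x y else 0) = m * (2 * a + (m - 1) * b) := by
  simp only [ite_and]
  rw [Fintype.sum_prod_type, Finset.sum_eq_single p]
  · rw [Finset.sum_congr rfl fun u _ => ?_, Finset.sum_const, Finset.card_univ, Fintype.card_fin,
      smul_eq_mul]
    simp only [if_true]
    rw [Fintype.sum_prod_type, Finset.sum_eq_single q]
    · simp only [if_true, sum_equalBlock_right, if_neg hpq]
    · intro q' _ hq'
      simp [hq']
    · simp
  · intro p' _ hp'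
    simp [hp']
  · simp

/-- This is why the diagonal entries are `2a`: together with the evenness of `m (m - 1)`, it makes
every exchange of two parts free of sign, whatever the parity of `b`. -/
theorem even_equalBlock_weight (m a b : ℕ) : Even (m * (2 * a + (m - 1) * b)) := by
  rw [mul_add, ← mul_assoc m (m - 1)]
  exact ((even_two_mul a).mul_left m).add ((Nat.even_mul_pred_self m).mul_right b)

theorem equalBlockEntry_finProdFinEquiv {m n : ℕ} (a b : ℕ) (x y : Fin n × Fin m) :
    equalBlockEntry m a b (finProdFinEquiv x) (finProdFinEquiv y) = equalBlock a b x y := by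
  obtain ⟨p, u⟩ := x
  obtain ⟨q, v⟩ := y
  have hm : 0 < m := u.pos
  simp [equalBlockEntry, equalBlock, Nat.add_mul_div_left _ _ hm, Nat.div_eq_of_lt u.2,
    Nat.div_eq_of_lt v.2, Nat.mod_eq_of_lt u.2, Nat.mod_eq_of_lt v.2, Fin.ext_iff]

theorem equalBlockMatrix_regular_and_ne_zero {k : Type*} [Field k] {N m n a b : ℕ}
    (hN : (N.factorial : k) ≠ 0) (hm : 0 < m) (hmn : N = m * n) (ha : 0 < a) (hb : 0 < b) :
    equalBlockMatrix N m a b ∈ regularEdgeMatrices N ((n - 1) * (2 * a + (m - 1) * b)) ∧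
      symmetrize (graphMonomial k (equalBlockMatrix N m a b)) ≠ 0 := by
  let e : Fin n × Fin m ≃ Fin N := finProdFinEquiv.trans (finCongr (by rw [hmn, mul_comm]))
  have he : ∀ x y, equalBlockMatrix N m a b (e x) (e y) = equalBlock a b x y :=
    equalBlockEntry_finProdFinEquiv a b
  refine ⟨mem_regularEdgeMatrices_of_equiv e he (equalBlock_comm a b)
    (fun x => if_pos rfl) (sum_equalBlock a b), ?_⟩
  refine symmetrize_graphMonomial_ne_zero_of_equiv hN e he (equalBlock_comm a b)
    (equalBlock_eq_zero_iff ha hb) (fun p => ⟨(p, ⟨0, hm⟩), rfl⟩) (fun _ => m) (fun p => ?_)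
    (fun _ _ => m * (2 * a + (m - 1) * b)) (fun p q => sum_equalBlock_blocks a b)
    fun π _ p q _ => ⟨rfl, fun _ => even_equalBlock_weight m a b⟩
  rw [sum_ite_fst_eq, mul_one]

/-! ### Equal blocks with one additional part. -/

/-- The adjacency of the extended block matrix. -/
def extendedBlock {m n p : ℕ} (a b c : ℕ) : (Fin n × Fin m) ⊕ Fin p → (Fin n × Fin m) ⊕ Fin p → ℕ
  | .inl x, .inl y => equalBlock a b x y
  | .inl _, .inr _ => c
  | .inr _, .inl _ => c
  | .inr _, .inr _ => 0

/-- The part of a vertex of the extended block matrix; the additional part is `⊥`. -/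
def extendedPart {m n p : ℕ} : (Fin n × Fin m) ⊕ Fin p → WithBot (Fin n) :=
  Sum.elim (fun x => x.1) fun _ => ⊥

theorem extendedBlock_comm {m n p : ℕ} (a b c : ℕ) (x y : (Fin n × Fin m) ⊕ Fin p) :
    extendedBlock a b c x y = extendedBlock a b c y x := by
  rcases x with x | x <;> rcases y with y | y <;> simp only [extendedBlock]
  exact equalBlock_comm a b x y

theorem extendedBlock_eq_zero_iff {m n p a b c : ℕ} (ha : 0 < a) (hb : 0 < b) (hc : 0 < c)
    (x y : (Fin n × Fin m) ⊕ Fin p) :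
    extendedBlock a b c x y = 0 ↔ extendedPart x = extendedPart y := by
  rcases x with x | x <;> rcases y with y | y <;>
    simp [extendedBlock, extendedPart, equalBlock_eq_zero_iff ha hb, hc.ne']

/-- The place of the additional block affects only the numbering, so both arrangements reduce to one
graph. -/
theorem exists_extendedBlock_equiv {N m n r p : ℕ} (a b c : ℕ) (hp : m * n = p + r)
    (hN : N = m * n + p) :
    ∃ e : (Fin n × Fin m) ⊕ Fin p ≃ Fin N,
      ∀ x y, extendedBlockMatrix N m n r a b c (e x) (e y) = extendedBlock a b c x y := by
  have hpr : m * n - r = p := by omega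
  have hlt : ∀ x : Fin n × Fin m, (finProdFinEquiv x : ℕ) < m * n := fun x =>
    (finProdFinEquiv x).2.trans_eq (mul_comm n m)
  by_cases h : p ≤ m
  · refine ⟨(Equiv.sumComm _ _).trans (((Equiv.refl _).sumCongr finProdFinEquiv).trans
      (finSumFinEquiv.trans (finCongr (by rw [hN, add_comm, mul_comm])))), ?_⟩
    rintro (x | x) (y | y) <;> simp only [extendedBlockMatrix, Matrix.of_apply, hpr, if_pos h]
    · simpa [extendedBlock] using equalBlockEntry_finProdFinEquiv a b x y
    · simp [extendedBlock]
    · simp [extendedBlock]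
    · simp [extendedBlock]
  · refine ⟨(finProdFinEquiv.sumCongr (Equiv.refl _)).trans
      (finSumFinEquiv.trans (finCongr (by rw [hN, mul_comm]))), ?_⟩
    rintro (x | x) (y | y) <;> simp only [extendedBlockMatrix, Matrix.of_apply, hpr, if_neg h]
    · have := equalBlockEntry_finProdFinEquiv a b x y
      have hx := hlt x
      have hy := hlt y
      simp_all [extendedBlock]
    · have hx := hlt x
      simp_all [extendedBlock, mul_comm n m]
    · have hy := hlt y
      simp_all [extendedBlock, mul_comm n m]
    · simp [extendedBlock, mul_comm n m]

/-- The equation `hc` expresses regularity: a vertex in a part of size `m` has degree `r c + p c = m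
n c`. For `p ≠ m` the additional part is fixed by all admissible permutations, so its edge counts
may be odd. -/
theorem extendedBlockMatrix_regular_and_ne_zero {k : Type*} [Field k] {N m n r p a b c : ℕ}
    (hN : (N.factorial : k) ≠ 0) (hm : 0 < m) (hn : 2 ≤ n) (hp0 : 0 < p) (hr : 0 < r)
    (hp : m * n = p + r) (hNp : N = m * n + p) (ha : 0 < a) (hb : 0 < b)
    (hc : r * c = (n - 1) * (2 * a + (m - 1) * b)) :
    extendedBlockMatrix N m n r a b c ∈ regularEdgeMatrices N (m * n * c) ∧
      symmetrize (graphMonomial k (extendedBlockMatrix N m n r a b c)) ≠ 0 := by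
  obtain ⟨e, he⟩ := exists_extendedBlock_equiv a b c hp hNp
  have hc0 : 0 < c := by
    refine Nat.pos_of_ne_zero fun h => ?_
    rw [h, mul_zero] at hc
    exact (Nat.mul_pos (by omega : 0 < n - 1) (by omega : 0 < 2 * a + (m - 1) * b)).ne hc
  refine ⟨mem_regularEdgeMatrices_of_equiv e he (extendedBlock_comm a b c) ?_ ?_, ?_⟩
  · rintro (x | x) <;> simp [extendedBlock, equalBlock]
  · rintro (x | x) <;> rw [Fintype.sum_sum_type] <;> simp only [extendedBlock]
    · rw [sum_equalBlock, ← hc, hp]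
      simp
      ring
    · simp [mul_comm n m]
  refine symmetrize_graphMonomial_ne_zero_of_equiv hN e he (extendedBlock_comm a b c)
    (extendedBlock_eq_zero_iff ha hb hc0) (fun q => ?_) (fun q => if q = ⊥ then p else m)
    (fun q => ?_)
    (fun q q' => if q = ⊥ ∨ q' = ⊥ then p * m * c else m * (2 * a + (m - 1) * b))
    (fun q q' hqq' => ?_) fun π hπ q q' hqq' => ?_
  · induction q with
    | bot => exact ⟨.inr ⟨0, hp0⟩, rfl⟩
    | coe q => exact ⟨.inl (q, ⟨0, hm⟩), rfl⟩
  · rw [Fintype.sum_sum_type]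
    induction q with
    | bot => simp [extendedPart]
    | coe q => simpa [extendedPart] using sum_ite_fst_eq m 1 q
  · simp only [Fintype.sum_sum_type, extendedBlock, extendedPart, Sum.elim_inl, Sum.elim_inr]
    induction q with
    | bot =>
      induction q' with
      | bot => exact absurd rfl hqq'
      | coe q' =>
        have := sum_ite_fst_eq m c q'
        simp [this, mul_assoc]
    | coe q =>
      induction q' with
      | bot =>
        have := sum_ite_fst_eq m (p * c) q
        simp [this]
        ring
      | coe q' =>
        have := sum_equalBlock_blocks (m := m) a b (mt (congrArg WithBot.some) hqq')
        simpa using this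
  · have heven := even_equalBlock_weight m a b
    by_cases hpm : p = m
    -- When `p = m` the additional part can be exchanged with the others; then `r = (n - 1) m`, and
    -- `hc` forces all edge counts to be equal, hence even.
    · have hcm : p * m * c = m * (2 * a + (m - 1) * b) := by
        have hr' : r = (n - 1) * m := by
          rw [Nat.sub_mul, mul_comm n m, hp, hpm]
          omega
        rw [hr', mul_assoc] at hc
        rw [hpm, mul_assoc, Nat.eq_of_mul_eq_mul_left (by omega) hc]
      simp only [hcm, ite_self]
      exact ⟨trivial, fun _ => heven⟩
    · have hbot : ∀ q, π q = ⊥ ↔ q = ⊥ := fun q => by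
        have := hπ q
        constructor <;> intro h <;> by_contra hq
        · rw [if_pos h, if_neg hq] at this
          exact hpm this
        · rw [if_neg hq, if_pos h] at this
          exact hpm this.symm
      refine ⟨by simp only [hbot], fun hlt => ?_⟩
      -- The additional part `⊥` is least and fixed by `π`, so a reversed pair consists of two parts
      -- of size `m`.
      have hq' : q' ≠ ⊥ := fun h => WithBot.not_lt_bot _ (h ▸ hqq')
      have hq : q ≠ ⊥ := mt (hbot q).2 fun h => WithBot.not_lt_bot _ (h ▸ hlt)
      rwa [if_neg (by tauto)]

/-! ### Three parts of distinct sizes. -/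

/-- The part of a vertex of the three-block matrix. -/
def threePart {l m n : ℕ} : Fin l ⊕ Fin m ⊕ Fin n → Fin 3 :=
  Sum.elim (fun _ => 0) (Sum.elim (fun _ => 1) fun _ => 2)

/-- Since the sizes are distinct, only the identity permutes the parts admissibly, and no parity
condition is needed. The equations `h1`, `h2`, `h3` are the row sums. -/
theorem threeBlockMatrix_regular_and_ne_zero {k : Type*} [Field k] {N l m n d a b c : ℕ}
    (hN : (N.factorial : k) ≠ 0) (hl : 0 < l) (hlm : l < m) (hmn : m < n) (hlmn : N = l + m + n)
    (ha : 0 < a) (hb : 0 < b) (hc : 0 < c) (h1 : m * a + n * b = d) (h2 : l * a + n * c = d)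
    (h3 : l * b + m * c = d) :
    threeBlockMatrix N l m a b c ∈ regularEdgeMatrices N d ∧
      symmetrize (graphMonomial k (threeBlockMatrix N l m a b c)) ≠ 0 := by
  let A' : Fin 3 → Fin 3 → ℕ := ![![0, a, b], ![a, 0, c], ![b, c, 0]]
  have hA' : ∀ p q, A' p q = A' q p := by
    intro p q
    fin_cases p <;> fin_cases q <;> rfl
  let e : Fin l ⊕ Fin m ⊕ Fin n ≃ Fin N := ((Equiv.refl _).sumCongr finSumFinEquiv).trans
    (finSumFinEquiv.trans (finCongr (by omega)))
  have he : ∀ x y, threeBlockMatrix N l m a b c (e x) (e y) = A' (threePart x) (threePart y) := by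
    rintro (x | x | x) (y | y | y) <;>
      simp [threeBlockMatrix, e, A', threePart]
  refine ⟨mem_regularEdgeMatrices_of_equiv e he (fun _ _ => hA' _ _) ?_ ?_, ?_⟩
  · rintro (x | x | x) <;> rfl
  · rintro (x | x | x) <;>
      simp [Fintype.sum_sum_type, threePart, A', h1, h2, h3]
  refine symmetrize_graphMonomial_ne_zero_of_equiv hN e he (fun _ _ => hA' _ _) (c := threePart)
    (fun x y => ?_) (fun p => ?_) ![l, m, n] (fun p => ?_) _ (fun p q _ => rfl)
    fun π hπ p q hpq => ?_
  · generalize threePart x = p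
    generalize threePart y = q
    fin_cases p <;> fin_cases q <;> simp [A', ha.ne', hb.ne', hc.ne']
  · fin_cases p
    · exact ⟨.inl ⟨0, hl⟩, rfl⟩
    · exact ⟨.inr (.inl ⟨0, by omega⟩), rfl⟩
    · exact ⟨.inr (.inr ⟨0, by omega⟩), rfl⟩
  · fin_cases p <;> simp [Fintype.sum_sum_type, threePart]
  · have hinj : Function.Injective ![l, m, n] := by
      intro p q
      fin_cases p <;> fin_cases q <;> simp <;> omega
    have hid : ∀ p, π p = p := fun p => hinj (hπ p)
    rw [hid, hid]
    exact ⟨rfl, fun h => absurd h hpq.not_gt⟩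

/-! ### The doubled graph. -/

/-- The vertices of the doubled graph: the new vertices come first. -/
def doubledEquiv {N : ℕ} (hN : 0 < N) : Fin (N - 1) ⊕ Fin N ≃ Fin (2 * N - 1) :=
  finSumFinEquiv.trans (finCongr (by omega))

theorem doubledEquiv_inl {N : ℕ} (hN : 0 < N) (u : Fin (N - 1)) :
    (doubledEquiv hN (.inl u) : ℕ) = u := by
  simp [doubledEquiv]

theorem doubledEquiv_inr {N : ℕ} (hN : 0 < N) (v : Fin N) :
    (doubledEquiv hN (.inr v) : ℕ) = N - 1 + v := by
  simp [doubledEquiv]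

section

variable {N : ℕ} (hN : 0 < N) (d : ℕ) (E : Matrix (Fin N) (Fin N) ℕ)

theorem doubledMatrix_inl_inl (u u' : Fin (N - 1)) :
    doubledMatrix d E (doubledEquiv hN (.inl u)) (doubledEquiv hN (.inl u')) = 0 := by
  simp [doubledMatrix, doubledEquiv_inl]

theorem doubledMatrix_inl_inr (u : Fin (N - 1)) (v : Fin N) :
    doubledMatrix d E (doubledEquiv hN (.inl u)) (doubledEquiv hN (.inr v)) = d := by
  simp [doubledMatrix, doubledEquiv_inl, doubledEquiv_inr]

theorem doubledMatrix_inr_inl (v : Fin N) (u : Fin (N - 1)) :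
    doubledMatrix d E (doubledEquiv hN (.inr v)) (doubledEquiv hN (.inl u)) = d := by
  simp [doubledMatrix, doubledEquiv_inl, doubledEquiv_inr]

theorem doubledMatrix_inr_inr (v v' : Fin N) :
    doubledMatrix d E (doubledEquiv hN (.inr v)) (doubledEquiv hN (.inr v')) = E v v' := by
  simp [doubledMatrix, doubledEquiv_inr]

end

theorem doubledMatrix_regular {N d : ℕ} (hN : 0 < N) {E : Matrix (Fin N) (Fin N) ℕ}
    (hE : E ∈ regularEdgeMatrices N d) :
    doubledMatrix d E ∈ regularEdgeMatrices (2 * N - 1) (d * N) := by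
  refine ⟨⟨Matrix.IsSymm.ext fun i j => ?_, fun i => ?_⟩, fun i => ?_⟩
  · obtain ⟨x | x, rfl⟩ := (doubledEquiv hN).surjective i <;>
      obtain ⟨y | y, rfl⟩ := (doubledEquiv hN).surjective j <;>
      simp only [doubledMatrix_inl_inl, doubledMatrix_inl_inr, doubledMatrix_inr_inl,
        doubledMatrix_inr_inr]
    exact hE.1.1.apply x y
  · obtain ⟨x | x, rfl⟩ := (doubledEquiv hN).surjective i
    · exact doubledMatrix_inl_inl hN d E x x
    · rw [doubledMatrix_inr_inr, hE.1.2]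
  · obtain ⟨x | x, rfl⟩ := (doubledEquiv hN).surjective i <;>
      rw [← (doubledEquiv hN).sum_comp, Fintype.sum_sum_type] <;>
      simp only [doubledMatrix_inl_inl, doubledMatrix_inl_inr, doubledMatrix_inr_inl,
        doubledMatrix_inr_inr, hE.2]
    · simp [mul_comm]
    · obtain ⟨M, rfl⟩ := Nat.exists_eq_succ_of_ne_zero hN.ne'
      simp
      ring

/-- New vertices precede the old ones, so every mixed pair occurs with the new vertex first and no
signs arise. -/
theorem prod_Ioi_doubledEquiv {M : Type*} [CommMonoid M] {N : ℕ} (hN : 0 < N)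
    (f : Fin (2 * N - 1) → Fin (2 * N - 1) → M) :
    ∏ i, ∏ j ∈ Finset.Ioi i, f i j =
      (∏ u, ∏ u' ∈ Finset.Ioi u, f (doubledEquiv hN (.inl u)) (doubledEquiv hN (.inl u'))) *
      (∏ u, ∏ v, f (doubledEquiv hN (.inl u)) (doubledEquiv hN (.inr v))) *
      ∏ v, ∏ v' ∈ Finset.Ioi v, f (doubledEquiv hN (.inr v)) (doubledEquiv hN (.inr v')) := by
  have hIoi : ∀ {n : ℕ} (i : Fin n) (g : Fin n → M),
      ∏ j ∈ Finset.Ioi i, g j = ∏ j, if i < j then g j else 1 := fun i g => by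
    rw [← Finset.prod_filter]
    congr 1
    ext
    simp
  simp only [hIoi]
  rw [← (doubledEquiv hN).prod_comp, Fintype.prod_sum_type]
  simp only [← (doubledEquiv hN).prod_comp (fun j => ite _ (f _ j) 1), Fintype.prod_sum_type,
    Fin.lt_def, doubledEquiv_inl, doubledEquiv_inr, Finset.prod_mul_distrib]
  have h1 : ∀ (u : Fin (N - 1)) (v : Fin N), (u : ℕ) < N - 1 + v := fun u v => by omega
  have h2 : ∀ (u : Fin (N - 1)) (v : Fin N), ¬ N - 1 + (v : ℕ) < u := fun u v => by omega
  simp only [h1, h2, if_true, if_false, Finset.prod_const_one, one_mul, add_lt_add_iff_left]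

/-- If a permutation carries an independent set of `N - 1` vertices of the doubled graph onto the
new vertices, then that set consists of the new vertices. -/
theorem isLeft_of_independent {N d : ℕ} (hN : 2 ≤ N) {E : Matrix (Fin N) (Fin N) ℕ}
    (hE : E ∈ regularEdgeMatrices N d) (hlt : ∀ i j, E i j < d)
    (σ : Equiv.Perm (Fin (N - 1) ⊕ Fin N))
    (hσ : ∀ x y, (σ x).isLeft → (σ y).isLeft →
      doubledMatrix d E (doubledEquiv (by omega) x) (doubledEquiv (by omega) y) = 0)
    (x : Fin (N - 1) ⊕ Fin N) (hx : (σ x).isLeft) : x.isLeft := by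
  have hd : 0 < d := (Nat.zero_le _).trans_lt (hlt ⟨0, by omega⟩ ⟨0, by omega⟩)
  rcases x with u | v
  · rfl
  exfalso
  -- An old vertex `v` in the independent set excludes all new ones, so the set contains at least `N
  -- - 1` of the `N` old vertices. The row of `v` then has at most one nonzero entry, which would
  -- have to equal `d`.
  have hleft : ∀ u : Fin (N - 1), ¬ (σ (.inl u)).isLeft := fun u hu => by
    have := hσ _ _ hu hx
    rw [doubledMatrix_inl_inr] at this
    exact hd.ne' this
  let B : Finset (Fin N) := {w | (σ (.inr w)).isLeft}
  have hB : N - 1 ≤ B.card := by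
    have h1 : ∀ u : Fin (N - 1), ∃ w, σ (.inr w) = .inl u := fun u => by
      obtain ⟨y | w, hy⟩ := σ.surjective (.inl u)
      · exact absurd (by rw [hy]; rfl) (hleft y)
      · exact ⟨w, hy⟩
    choose w hw using h1
    rw [← Fintype.card_fin (N - 1), ← Finset.card_univ]
    refine Finset.card_le_card_of_injOn w (fun u _ => ?_) fun u _ u' _ h => ?_
    · simp [B, hw]
    · have := hw u
      rw [h, hw] at this
      exact (Sum.inl_injective this).symm
  have hcompl : Bᶜ.card ≤ 1 := by
    rw [Finset.card_compl, Fintype.card_fin]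
    omega
  have hzero : ∀ w ∈ B, E v w = 0 := fun w hw => by
    rw [← doubledMatrix_inr_inr (by omega) d E]
    exact hσ _ _ hx (by simpa [B] using hw)
  have hsum := hE.2 v
  rw [← Finset.sum_compl_add_sum B, Finset.sum_eq_zero hzero, add_zero] at hsum
  obtain h0 | h1 := Nat.le_one_iff_eq_zero_or_eq_one.1 hcompl
  · rw [Finset.card_eq_zero.1 h0, Finset.sum_empty] at hsum
    omega
  · obtain ⟨w, hw⟩ := Finset.card_eq_one.1 h1
    rw [hw, Finset.sum_singleton] at hsum
    exact (hlt v w).ne hsum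

theorem symmetrize_doubledMatrix_ne_zero {k : Type*} [Field k] {N d : ℕ} (hN : 2 ≤ N)
    (hk : (N.factorial : k) ≠ 0) {E : Matrix (Fin N) (Fin N) ℕ}
    (hE : E ∈ regularEdgeMatrices N d) (hlt : ∀ i j, E i j < d)
    (h : symmetrize (graphMonomial k E) ≠ 0) :
    symmetrize (graphMonomial k (doubledMatrix d E)) ≠ 0 := by
  classical
  have hN0 : 0 < N := by omega
  let e := doubledEquiv hN0
  let y : Fin (N - 1) ⊕ Fin N → MvPolynomial (Option (Fin N)) k :=
    Sum.elim (fun _ => MvPolynomial.X none) fun v => MvPolynomial.X (some v)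
  let φ : MvPolynomial (Fin (2 * N - 1)) k →ₐ[k] MvPolynomial (Option (Fin N)) k :=
    MvPolynomial.aeval fun i => y (e.symm i)
  let Q : MvPolynomial (Option (Fin N)) k :=
    ∏ _u : Fin (N - 1), ∏ v : Fin N, (MvPolynomial.X none - MvPolynomial.X (some v)) ^ d
  have hφ : ∀ σ : Equiv.Perm (Fin (N - 1) ⊕ Fin N),
      φ (MvPolynomial.rename (e.permCongr σ) (graphMonomial k (doubledMatrix d E))) =
      ∏ i, ∏ j ∈ Finset.Ioi i,
        (y (σ (e.symm i)) - y (σ (e.symm j))) ^ doubledMatrix d E i j := fun σ => by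
    simp [φ, graphMonomial, map_prod]
  have hsplit : ∀ α : Equiv.Perm (Fin (N - 1)), ∀ β : Equiv.Perm (Fin N),
      φ (MvPolynomial.rename (e.permCongr (Equiv.Perm.sumCongr α β))
        (graphMonomial k (doubledMatrix d E))) =
      Q * MvPolynomial.rename some (MvPolynomial.rename β (graphMonomial k E)) := by
    intro α β
    rw [hφ, prod_Ioi_doubledEquiv hN0]
    simp only [doubledMatrix_inl_inl, doubledMatrix_inl_inr, doubledMatrix_inr_inr, pow_zero,
      Finset.prod_const_one, one_mul, e, Equiv.symm_apply_apply, Equiv.Perm.sumCongr_apply,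
      Sum.map_inl, Sum.map_inr, y, Sum.elim_inl, Sum.elim_inr, Q]
    congr 1
    -- The mixed factors run over all old vertices, so `β` merely reorders them.
    · refine Finset.prod_congr rfl fun u _ => ?_
      exact Equiv.prod_comp β fun v => (MvPolynomial.X none - MvPolynomial.X (some v) :
        MvPolynomial (Option (Fin N)) k) ^ d
    · simp [graphMonomial, map_prod]
  have hzero : ∀ σ : Equiv.Perm (Fin (N - 1) ⊕ Fin N),
      σ ∉ (Equiv.Perm.sumCongrHom (Fin (N - 1)) (Fin N)).range →
      φ (MvPolynomial.rename (e.permCongr σ) (graphMonomial k (doubledMatrix d E))) = 0 := by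
    intro σ hσ
    obtain ⟨a, b, ha, hb, hab⟩ : ∃ a b, (σ a).isLeft ∧ (σ b).isLeft ∧
        doubledMatrix d E (e a) (e b) ≠ 0 := by
      by_contra! hcon
      -- If no adjacent pair were sent into the new vertices, `σ⁻¹` would preserve the set of new
      -- vertices, and `σ` would be a pair of permutations of the blocks.
      refine hσ (inv_mem_iff.1 (Equiv.Perm.mem_sumCongrHom_range_of_perm_mapsTo_inl ?_))
      rintro _ ⟨u, rfl⟩
      have := isLeft_of_independent hN hE hlt σ hcon (σ⁻¹ (.inl u)) (by simp)
      obtain ⟨u', hu'⟩ := Sum.isLeft_iff.1 this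
      exact ⟨u', hu'.symm⟩
    have hreg := doubledMatrix_regular hN0 hE
    wlog hlt : e a < e b generalizing a b
    · refine this b a hb ha (by rwa [hreg.1.1.apply]) (lt_of_le_of_ne (not_lt.1 hlt) fun h => ?_)
      rw [h, hreg.1.2] at hab
      exact hab rfl
    rw [hφ]
    refine Finset.prod_eq_zero (Finset.mem_univ (e a))
      (Finset.prod_eq_zero (Finset.mem_Ioi.2 hlt) ?_)
    obtain ⟨u, hu⟩ := Sum.isLeft_iff.1 ha
    obtain ⟨u', hu'⟩ := Sum.isLeft_iff.1 hb
    rw [Equiv.symm_apply_apply, Equiv.symm_apply_apply, hu, hu']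
    simp only [y, Sum.elim_inl, sub_self]
    exact zero_pow hab
  have hsum : φ (symmetrize (graphMonomial k (doubledMatrix d E))) =
      ((N - 1).factorial : MvPolynomial (Option (Fin N)) k) *
        (Q * MvPolynomial.rename some (symmetrize (graphMonomial k E))) := by
    rw [symmetrize, map_sum, ← Equiv.sum_comp e.permCongr]
    rw [← Finset.sum_of_injOn (s := Finset.univ)
      (f := fun ab : Equiv.Perm (Fin (N - 1)) × Equiv.Perm (Fin N) =>
        Q * MvPolynomial.rename some (MvPolynomial.rename ab.2 (graphMonomial k E)))
      (Equiv.Perm.sumCongrHom _ _) Equiv.Perm.sumCongrHom_injective.injOn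
      (fun _ _ => Finset.mem_coe.2 (Finset.mem_univ _))
      (fun σ _ hσ => hzero σ fun ⟨ab, hab⟩ => hσ ⟨ab, by simp, hab⟩)
      (fun ab _ => (hsplit ab.1 ab.2).symm)]
    rw [Fintype.sum_prod_type]
    simp only [symmetrize, map_sum, Finset.mul_sum]
    simp [Fintype.card_perm, Finset.mul_sum]
  intro h0
  rw [h0, map_zero] at hsum
  refine mul_ne_zero ?_ (mul_ne_zero ?_ ?_) hsum.symm
  -- Only `(N - 1)!` has to be nonzero in `k`, so a characteristic above `N` suffices although `2N -
  -- 1` roots are permuted.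
  · intro hf
    apply hk
    have hf' : ((N - 1).factorial : k) = 0 :=
      MvPolynomial.C_injective (Option (Fin N)) k (by simpa using hf)
    rw [← Nat.mul_factorial_pred hN0.ne', Nat.cast_mul, hf', mul_zero]
  · refine Finset.prod_ne_zero_iff.2 fun _ _ => Finset.prod_ne_zero_iff.2 fun v _ =>
      pow_ne_zero _ (sub_ne_zero.2 fun h => ?_)
    cases MvPolynomial.X_injective h
  · exact fun hr => h (MvPolynomial.rename_injective _ (Option.some_injective _) (by simpa using hr))

/-! ### The hypothesis on the characteristic, and the five families. -/

theorem factorial_cast_ne_zero {k : Type*} [Field k] {N : ℕ}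
    (hk : ringChar k = 0 ∨ N < ringChar k) : (N.factorial : k) ≠ 0 := by
  rw [Ne, ringChar.spec]
  obtain h | h := hk
  · rw [h, zero_dvd_iff]
    exact N.factorial_ne_zero
  · have hp : (ringChar k).Prime :=
      (CharP.char_is_prime_or_zero k (ringChar k)).resolve_right (by omega)
    rw [hp.dvd_factorial]
    omega

theorem theorem2 {k : Type*} [Field k] (N : ℕ) (hN : 3 ≤ N)
    (hk : ringChar k = 0 ∨ N < ringChar k) :
    -- (i)
    (∀ m n a b d : ℕ, 0 < m → 2 ≤ n → N = m * n → 0 < a → 0 < b →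
      d = 2 * a * (n - 1) + (m - 1) * (n - 1) * b →
      equalBlockMatrix N m a b ∈ regularEdgeMatrices N d ∧
      ∃ w : ℕ, IsNonzeroInvariant d w (symmetrize (graphMonomial k (equalBlockMatrix N m a b)))) ∧
    -- (ii)
    (∀ m n r a b c : ℕ, 0 < m → 2 ≤ n → 1 ≤ r → r ≤ m * n - 1 → N = 2 * m * n - r →
      0 < a → 0 < b →
      (c : ℚ) = (2 * ((n : ℚ) - 1) * a + ((m : ℚ) - 1) * ((n : ℚ) - 1) * b) / r →
      extendedBlockMatrix N m n r a b c ∈ regularEdgeMatrices N (m * n * c) ∧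
      ∃ w : ℕ, IsNonzeroInvariant (m * n * c) w
        (symmetrize (graphMonomial k (extendedBlockMatrix N m n r a b c)))) ∧
    -- (iii)
    (∀ l m n d a b c : ℕ, 0 < l → l < m → m < n → n < l + m → N = l + m + n → 0 < d →
      (a : ℚ) = ((m : ℚ) + l - n) * d / (2 * l * m) →
      (b : ℚ) = ((l : ℚ) + n - m) * d / (2 * l * n) →
      (c : ℚ) = ((m : ℚ) + n - l) * d / (2 * m * n) →
      threeBlockMatrix N l m a b c ∈ regularEdgeMatrices N d ∧
      ∃ w : ℕ, IsNonzeroInvariant d w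
        (symmetrize (graphMonomial k (threeBlockMatrix N l m a b c)))) ∧
    -- (iv) (an invariant is skew if its weight is odd); the matrix of (ii) for the indicated values of `m, n, r, a, b, c`
    (∀ s t u v d w : ℕ, 0 < t → 0 < u → 0 < v → t ≤ 2 * u → 2 * u ≤ 2 * t - 1 →
      N = 2 * (2 * t * v + 1) →
      d = (2 * s + 1) * (2 * u + 1) * (4 * u * v + 2 * v + 1) →
      w = (2 * s + 1) * (2 * t * v + 1) * (2 * u + 1) * (4 * u * v + 2 * v + 1) →
      ∀ E : Matrix (Fin N) (Fin N) ℕ,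
      E = extendedBlockMatrix N 1 (4 * u * v + 2 * v + 1) (8 * u * v + 4 * v - 4 * t * v)
        ((2 * s + 1) * (2 * u + 1 - t)) 1 ((2 * s + 1) * (2 * u + 1)) →
      E ∈ regularEdgeMatrices N d ∧
      IsNonzeroInvariant d w (symmetrize (graphMonomial k E)) ∧ Odd w) ∧
    -- (v)
    (∀ (d : ℕ) (E : Matrix (Fin N) (Fin N) ℕ), E ∈ regularEdgeMatrices N d →
      (∀ i j, E i j < d) → symmetrize (graphMonomial k E) ≠ 0 →
      doubledMatrix d E ∈ regularEdgeMatrices (2 * N - 1) (d * N) ∧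
      ∃ w : ℕ, IsNonzeroInvariant (d * N) w
        (symmetrize (graphMonomial k (doubledMatrix d E)))) := by
  have hfac := factorial_cast_ne_zero hk
  have : NeZero N := ⟨by omega⟩
  refine ⟨?_, ?_, ?_, ?_, ?_⟩
  · intro m n a b d hm hn hmn ha hb hd
    obtain ⟨hreg, hne⟩ := equalBlockMatrix_regular_and_ne_zero (k := k) hfac hm hmn ha hb
    rw [show (n - 1) * (2 * a + (m - 1) * b) = d by rw [hd]; ring] at hreg
    exact ⟨hreg, exists_isNonzeroInvariant_symmetrize_graphMonomial hreg hne⟩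
  · intro m n r a b c hm hn hr hrmn hNmn ha hb hc
    have hmn : 0 < m * n := Nat.mul_pos hm (by omega)
    have hNmn' : N = 2 * (m * n) - r := by rw [hNmn, mul_assoc]
    obtain ⟨hreg, hne⟩ := extendedBlockMatrix_regular_and_ne_zero (k := k) (p := m * n - r) hfac hm
      hn (by omega) hr (by omega) (by omega) ha hb (c := c) (by
        have hr0 : (r : ℚ) ≠ 0 := by positivity
        rw [eq_div_iff hr0] at hc
        have : ((r * c : ℕ) : ℚ) = ((n - 1) * (2 * a + (m - 1) * b) : ℕ) := by
          push_cast [Nat.cast_sub (show 1 ≤ n by omega), Nat.cast_sub (show 1 ≤ m from hm)]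
          linarith
        exact_mod_cast this)
    exact ⟨hreg, exists_isNonzeroInvariant_symmetrize_graphMonomial hreg hne⟩
  · intro l m n d a b c hl hlm hmn hnlm hNlmn hd ha hb hc
    have hl' : (0 : ℚ) < l := by exact_mod_cast hl
    have hm' : (0 : ℚ) < m := by exact_mod_cast hl.trans hlm
    have hn' : (0 : ℚ) < n := by exact_mod_cast (hl.trans hlm).trans hmn
    have hd' : (0 : ℚ) < d := by exact_mod_cast hd
    have hlm' : (l : ℚ) < m := by exact_mod_cast hlm
    have hmn' : (m : ℚ) < n := by exact_mod_cast hmn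
    have hnlm' : (n : ℚ) < l + m := by exact_mod_cast hnlm
    have ha0 : 0 < a := by
      have : (0 : ℚ) < a := by
        rw [ha]
        exact div_pos (mul_pos (by linarith) hd') (by positivity)
      exact_mod_cast this
    have hb0 : 0 < b := by
      have : (0 : ℚ) < b := by
        rw [hb]
        exact div_pos (mul_pos (by linarith) hd') (by positivity)
      exact_mod_cast this
    have hc0 : 0 < c := by
      have : (0 : ℚ) < c := by
        rw [hc]
        exact div_pos (mul_pos (by linarith) hd') (by positivity)
      exact_mod_cast this
    have h1 : m * a + n * b = d := by
      have : (m * a + n * b : ℚ) = d := by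
        rw [ha, hb]
        field_simp
        ring
      exact_mod_cast this
    have h2 : l * a + n * c = d := by
      have : (l * a + n * c : ℚ) = d := by
        rw [ha, hc]
        field_simp
        ring
      exact_mod_cast this
    have h3 : l * b + m * c = d := by
      have : (l * b + m * c : ℚ) = d := by
        rw [hb, hc]
        field_simp
        ring
      exact_mod_cast this
    obtain ⟨hreg, hne⟩ := threeBlockMatrix_regular_and_ne_zero (k := k) hfac hl hlm hmn hNlmn
      ha0 hb0 hc0 h1 h2 h3
    exact ⟨hreg, exists_isNonzeroInvariant_symmetrize_graphMonomial hreg hne⟩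
  · intro s t u v d w ht hu hv htu hut hNtv hd hw E hE
    -- With `x = 2u - t` and `z = 2t - 2u - 1`, both nonnegative by the hypotheses, `r = 4v(x + 1)`
    -- and the additional part has size `2vz + 1`. This removes the truncated subtractions and shows
    -- that `r` and this size are positive.
    obtain ⟨x, hx⟩ := Nat.exists_eq_add_of_le htu
    obtain ⟨z, hz⟩ := Nat.exists_eq_add_of_le (show 2 * u + 1 ≤ 2 * t by omega)
    have hsub : 2 * u + 1 - t = x + 1 := by omega
    have hr : 8 * u * v + 4 * v - 4 * t * v = 4 * v * (x + 1) := by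
      rw [← hsub, Nat.mul_sub]
      congr 1 <;> ring
    have hp : 1 * (4 * u * v + 2 * v + 1) = (2 * v * z + 1) + 4 * v * (x + 1) := by
      have h1 : 4 * u * v + 2 * v = 2 * v * (2 * u + 1) := by ring
      have h2 : 2 * v * z + 4 * v * (x + 1) = 2 * v * (z + 2 * (x + 1)) := by ring
      rw [one_mul, h1, show 2 * u + 1 = z + 2 * (x + 1) by omega]
      ring
    have hNp : N = 1 * (4 * u * v + 2 * v + 1) + (2 * v * z + 1) := by
      have h1 : 2 * (2 * t * v + 1) = 2 * v * (2 * t) + 2 := by ring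
      rw [hNtv, h1, hz]
      ring
    obtain ⟨hreg, hne⟩ := extendedBlockMatrix_regular_and_ne_zero (k := k)
      (a := (2 * s + 1) * (2 * u + 1 - t)) (b := 1) (c := (2 * s + 1) * (2 * u + 1)) hfac one_pos
      (by nlinarith) (Nat.succ_pos _) (by positivity) hp hNp
      (Nat.mul_pos (by omega) (by omega)) one_pos (by
        rw [hsub, Nat.add_sub_cancel, Nat.sub_self]
        ring)
    rw [← hr, ← hE] at hreg hne
    rw [show 1 * (4 * u * v + 2 * v + 1) * ((2 * s + 1) * (2 * u + 1)) = d by rw [hd]; ring] at hreg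
    refine ⟨hreg, isNonzeroInvariant_symmetrize_graphMonomial hreg ?_ hne, ?_⟩
    · rw [hw, hNtv, hd]
      ring
    · rw [hw]
      refine ((Odd.mul ?_ ?_).mul ?_).mul ?_
      · exact odd_two_mul_add_one s
      · exact ⟨t * v, by ring⟩
      · exact odd_two_mul_add_one u
      · exact ⟨2 * u * v + v, by ring⟩
  · intro d E hE hlt hne
    have hreg := doubledMatrix_regular (by omega) hE
    have : NeZero (2 * N - 1) := ⟨by omega⟩
    exact ⟨hreg, exists_isNonzeroInvariant_symmetrize_graphMonomial hreg
      (symmetrize_doubledMatrix_ne_zero (by omega) hfac hE hlt hne)⟩
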